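/- Theorem 4.1 (Horn–Mathias–Nakamura characterization). Let $n\ge 1$, and for $A\in M_n(\mathbb C)$ let $\sigma_1(A)\ge\dots\ge\sigma_n(A)$ denote the singular values of $A$. Let $\bullet : M_n(\mathbb C)\times M_n(\mathbb C)\to M_n(\mathbb C)$ be a bilinear map which is symmetric, i.e. $A\bullet B=B\bullet A$ for all $A,B$, and let $\bullet_R : M_n(\mathbb C)\times M_n(\mathbb C)\to M_n(\mathbb C)$ be the unique bilinear map such that $\operatorname{Tr}\big((A\bullet B)C\big)=\operatorname{Tr}\big((B\bullet_R C)A\big)$ for all $A,B,C\in M_n(\mathbb C)$. Then the inequalities $$\sum_{i=1}^k \sigma_i(A\bullet B)\le \sum_{i=1}^k \sigma_i(A)\,\sigma_i(B)\qquad (1\le k\le n)$$ hold for all $A,B\in M_n(\mathbb C)$ if and only if $$\sigma_1(A\bullet B)\le \sigma_1(A)\,\sigma_1(B)\quad\text{and}\quad \sigma_1(A\bullet_R B)\le \sigma_1(A)\,\sigma_1(B)$$ hold for all $A,B\in M_n(\mathbb C)$. -/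

import Mathlib

/-- The complex `n × n` matrices. -/
abbrev MatC (n : ℕ) : Type := Matrix (Fin n) (Fin n) ℂ

/-- A bilinear form (product) `(A, B) ↦ A • B` on `M_n(ℂ)`, with values in `M_n(ℂ)`. -/
abbrev BilinProd (n : ℕ) : Type := MatC n →ₗ[ℂ] MatC n →ₗ[ℂ] MatC n

/-- The singular values of a matrix in decreasing order, with multiplicity, counted from zero:
`sv A 0` is the largest one and `sv A (n - 1)` the smallest. -/
noncomputable def sv {n : ℕ} (A : MatC n) (i : ℕ) : ℝ :=
  (Matrix.toEuclideanLin A).singularValues i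

/-- The form `•_R` attached to a bilinear form `•`. It is given here by its matrix entries
`(B •_R C) i j = Tr ((E_{j i} • B) C)`; by `trace_rightProd` and `rightProd_unique` it is the
only form with `Tr ((A • B) C) = Tr ((B •_R C) A)` for all `A`, `B`, `C`. -/
noncomputable def rightProd {n : ℕ} (p : BilinProd n) : BilinProd n :=
  LinearMap.mk₂ ℂ
    (fun B C => Matrix.of fun i j => Matrix.trace (p (Matrix.single j i 1) B * C))
    (fun B₁ B₂ C => by ext i j; simp [add_mul])
    (fun c B C => by ext i j; simp)
    (fun B C₁ C₂ => by ext i j; simp [mul_add])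
    (fun c B C => by ext i j; simp)

theorem trace_rightProd {n : ℕ} (p : BilinProd n) (A B C : MatC n) :
    Matrix.trace (p A B * C) = Matrix.trace (rightProd p B C * A) := by
  have hA : A = ∑ i, ∑ j, A i j • Matrix.single i j (1 : ℂ) := by
    conv_lhs => rw [Matrix.matrix_eq_sum_single A]
    simp [Matrix.smul_single]
  conv_lhs => rw [hA]
  simp only [map_sum, map_smul, LinearMap.sum_apply, LinearMap.smul_apply, Finset.sum_mul,
    Matrix.trace_sum, smul_mul_assoc, Matrix.trace_smul, smul_eq_mul]
  rw [Finset.sum_comm]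
  simp only [rightProd, LinearMap.mk₂_apply, Matrix.trace, Matrix.diag_apply, Matrix.mul_apply,
    Matrix.of_apply]
  refine Finset.sum_congr rfl fun i _ => Finset.sum_congr rfl fun j _ => ?_
  rw [mul_comm]

theorem rightProd_unique {n : ℕ} (p q : BilinProd n)
    (h : ∀ A B C : MatC n, Matrix.trace (p A B * C) = Matrix.trace (q B C * A)) :
    q = rightProd p := by
  refine LinearMap.ext fun B => LinearMap.ext fun C => ?_
  refine Matrix.ext_iff_trace_mul_right.mpr fun A => ?_
  rw [← h, trace_rightProd]

open scoped Matrix.Norms.L2Operator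
open Matrix

/-! With `P_j = diagProj n j`, each matrix is a combination of partial isometries `U P_j V` with
weights `σ_j - σ_{j+1} ≥ 0` (1-based), by Abel summation in its singular value decomposition, and
the sum of its `k` largest singular values is its trace against some `U P_k V`. So the inequalities
reduce to bounding `Tr ((A • B) C)` for partial isometries of ranks at most `i, j, k` by `min i j k`
(`norm_trace_diagProj_le_min`): spectral contractivity bounds the trace by the rank of the factor
standing outside the product, and `•_R` with symmetry lets any of the three stand there. Resumming
these minima gives exactly `∑ σ_l(A) σ_l(B)` (`sum_sv_mul_sv`).

Conversely, only `k = 1` and `k = n` are needed; the latter bounds `•_R` by duality of the trace and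
spectral norms. -/

theorem sv_nonneg {n : ℕ} (A : MatC n) (i : ℕ) : 0 ≤ sv A i :=
  LinearMap.singularValues_nonneg _ i

theorem sv_antitone {n : ℕ} (A : MatC n) : Antitone (sv A) :=
  LinearMap.singularValues_antitone _

theorem sv_of_le {n : ℕ} (A : MatC n) {i : ℕ} (hi : n ≤ i) : sv A i = 0 :=
  LinearMap.singularValues_of_finrank_le _ (by simpa using hi)

/-- Eigenvectors of `T* T` have orthogonal images of length `σ_i`; the nonzero images are normalised
and completed to a basis. -/
theorem LinearMap.exists_orthonormalBasis_singularValues {n : ℕ}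
    (T : EuclideanSpace ℂ (Fin n) →ₗ[ℂ] EuclideanSpace ℂ (Fin n)) :
    ∃ u v : OrthonormalBasis (Fin n) ℂ (EuclideanSpace ℂ (Fin n)),
      ∀ i, T (v i) = (T.singularValues i : ℂ) • u i := by
  have hn : Module.finrank ℂ (EuclideanSpace ℂ (Fin n)) = n := by simp
  let v := T.isSymmetric_adjoint_comp_self.eigenvectorBasis hn
  have key (i j : Fin n) :
      inner ℂ (T (v i)) (T (v j)) = if i = j then (T.singularValues j : ℂ) ^ 2 else 0 := by
    rw [← LinearMap.adjoint_inner_right, ← LinearMap.comp_apply,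
      T.isSymmetric_adjoint_comp_self.apply_eigenvectorBasis hn j, ← T.sq_singularValues_fin hn,
      inner_smul_right, orthonormal_iff_ite.mp v.orthonormal]
    simp
  obtain ⟨u, hu⟩ := Orthonormal.exists_orthonormalBasis_extension_of_card_eq (𝕜 := ℂ)
    (v := fun i : Fin n => ((T.singularValues i : ℂ)⁻¹) • T (v i))
    (s := {i | T.singularValues i ≠ 0}) (by simp) (by
      rw [orthonormal_iff_ite]
      rintro ⟨i, hi⟩ ⟨j, hj⟩
      have hj' : (T.singularValues j : ℂ) ≠ 0 := by exact_mod_cast hj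
      simp only [Set.domRestrict_apply, inner_smul_left, inner_smul_right, key, Subtype.mk.injEq]
      split_ifs with h
      · subst h
        simp
        field_simp
      · simp)
  refine ⟨u, v, fun i => ?_⟩
  by_cases h : T.singularValues i = 0
  · have := key i i
    simp only [h, if_true] at this
    simp only [h]
    simpa using this
  · rw [hu i h, smul_smul, mul_inv_cancel₀ (by exact_mod_cast h), one_smul]

theorem exists_unitary_mul_diagonal_sv {n : ℕ} (A : MatC n) :
    ∃ U ∈ unitaryGroup (Fin n) ℂ, ∃ V ∈ unitaryGroup (Fin n) ℂ,
      A = U * diagonal (fun i : Fin n => (sv A i : ℂ)) * Vᴴ := by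
  obtain ⟨u, v, h⟩ := (toEuclideanLin A).exists_orthonormalBasis_singularValues
  let e := EuclideanSpace.basisFun (Fin n) ℂ
  have hV := e.toMatrix_orthonormalBasis_mem_unitary v
  refine ⟨_, e.toMatrix_orthonormalBasis_mem_unitary u, _, hV, ?_⟩
  have hAV : A * e.toBasis.toMatrix v
      = e.toBasis.toMatrix u * diagonal (fun i : Fin n => (sv A i : ℂ)) := by
    ext i j
    have := congrArg (fun x : EuclideanSpace ℂ (Fin n) => x i) (h j)
    simp only [PiLp.smul_apply, toLpLin_apply, mulVec, dotProduct] at this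
    rw [mul_diagonal]
    simp only [mul_apply, Module.Basis.toMatrix_apply]
    simpa [e, sv, mul_comm] using this
  rw [← hAV, mul_assoc]
  have := (mem_unitaryGroup_iff (A := e.toBasis.toMatrix v)).mp hV
  rw [star_eq_conjTranspose] at this
  rw [this, mul_one]

theorem norm_mul_mul_of_mem_unitary {n : ℕ} {U V : MatC n} (hU : U ∈ unitaryGroup (Fin n) ℂ)
    (hV : V ∈ unitaryGroup (Fin n) ℂ) (A : MatC n) : ‖U * A * V‖ = ‖A‖ := by
  rw [CStarRing.norm_mul_mem_unitary _ hV, CStarRing.norm_mem_unitary_mul _ hU]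

theorem norm_eq_sv_zero {n : ℕ} (A : MatC n) : ‖A‖ = sv A 0 := by
  obtain ⟨U, hU, V, hV, h⟩ := exists_unitary_mul_diagonal_sv A
  have hA : ‖A‖ = ‖fun i : Fin n => (sv A i : ℂ)‖ := by
    conv_lhs => rw [h]
    exact (norm_mul_mul_of_mem_unitary hU (Unitary.star_mem hV) _).trans (l2_opNorm_diagonal _)
  rw [hA]
  refine le_antisymm ((pi_norm_le_iff_of_nonneg (sv_nonneg A 0)).mpr fun i => ?_) ?_
  · simpa [abs_of_nonneg (sv_nonneg A _)] using sv_antitone A (Nat.zero_le _)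
  · rcases n.eq_zero_or_pos with rfl | hn
    · simp [sv_of_le A le_rfl]
    · simpa [abs_of_nonneg (sv_nonneg A _)] using
        norm_le_pi_norm (fun i : Fin n => (sv A i : ℂ)) ⟨0, hn⟩

theorem norm_apply_le_l2_opNorm {n : ℕ} (A : MatC n) (i j : Fin n) : ‖A i j‖ ≤ ‖A‖ := by
  have h := l2_opNorm_mulVec A (EuclideanSpace.single j (1 : ℂ))
  have h' := (PiLp.norm_apply_le (WithLp.toLp 2 (A *ᵥ (EuclideanSpace.single j (1 : ℂ)).ofLp)) i)
  simpa using h'.trans h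

/-- Cyclicity turns the trace into the diagonal of `V X U` weighted by `d`, and no entry exceeds the
spectral norm. -/
theorem norm_trace_mul_unitary_diagonal_le {n : ℕ} {U V : MatC n}
    (hU : U ∈ unitaryGroup (Fin n) ℂ) (hV : V ∈ unitaryGroup (Fin n) ℂ) (X : MatC n)
    (d : Fin n → ℂ) : ‖trace (X * (U * diagonal d * V))‖ ≤ ‖X‖ * ∑ i, ‖d i‖ := by
  have : trace (X * (U * diagonal d * V)) = ∑ i, (V * X * U) i i * d i := by
    rw [← mul_assoc, ← mul_assoc, trace_mul_comm, ← mul_assoc, ← mul_assoc]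
    simp [trace, mul_diagonal]
  rw [this, Finset.mul_sum]
  refine norm_sum_le_of_le _ fun i _ => ?_
  rw [norm_mul, ← norm_mul_mul_of_mem_unitary hV hU X]
  gcongr
  exact norm_apply_le_l2_opNorm _ i i

/-- The diagonal projection onto the coordinates with index less than `k`. -/
noncomputable def diagProj (n k : ℕ) : MatC n :=
  diagonal fun i : Fin n => if (i : ℕ) < k then 1 else 0

theorem norm_diagProj_le_one (n k : ℕ) : ‖diagProj n k‖ ≤ 1 := by
  rw [diagProj, l2_opNorm_diagonal, pi_norm_le_iff_of_nonneg zero_le_one]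
  intro i
  split_ifs <;> simp

theorem rank_diagProj_le (n k : ℕ) : (diagProj n k).rank ≤ k := by
  rw [diagProj, rank_diagonal, Fintype.card_subtype]
  calc _ ≤ (Finset.range k).card :=
        Finset.card_le_card_of_injOn (fun i : Fin n => (i : ℕ)) (fun i hi => by simpa using hi)
          Fin.val_injective.injOn
    _ = k := by simp

theorem sv_eq_zero_of_rank_le {n : ℕ} {A : MatC n} {i : ℕ} (h : A.rank ≤ i) : sv A i = 0 := by
  rw [sv, LinearMap.singularValues_eq_zero_iff_le_finrank_range]
  rwa [toEuclideanLin_eq_toLin_orthonormal, ← rank_eq_finrank_range_toLin]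

theorem norm_trace_mul_unitary_diagProj_le {n : ℕ} {U V : MatC n}
    (hU : U ∈ unitaryGroup (Fin n) ℂ) (hV : V ∈ unitaryGroup (Fin n) ℂ) {X : MatC n}
    (hX : ‖X‖ ≤ 1) (k : ℕ) : ‖trace (X * (U * diagProj n k * V))‖ ≤ k := by
  refine (norm_trace_mul_unitary_diagonal_le hU hV X _).trans ?_
  calc _ ≤ 1 * ∑ i : Fin n, ‖(if (i : ℕ) < k then 1 else 0 : ℂ)‖ := by gcongr
    _ = ((Finset.univ.filter fun i : Fin n => (i : ℕ) < k).card : ℝ) := by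
      simp [apply_ite norm, Finset.sum_boole]
    _ ≤ ((Finset.range k).card : ℝ) := by
      exact_mod_cast Finset.card_le_card_of_injOn (fun i : Fin n => (i : ℕ))
        (fun i hi => by simpa using hi) Fin.val_injective.injOn
    _ = k := by simp

theorem exists_unitary_trace_eq_sum_sv {n : ℕ} (A : MatC n) :
    ∃ U ∈ unitaryGroup (Fin n) ℂ, ∃ V ∈ unitaryGroup (Fin n) ℂ, ∀ k ≤ n,
      trace (A * (U * diagProj n k * V)) = ∑ i ∈ Finset.range k, (sv A i : ℂ) := by
  obtain ⟨U, hU, V, hV, h⟩ := exists_unitary_mul_diagonal_sv A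
  have hU' : Uᴴ * U = 1 := mem_unitaryGroup_iff'.mp hU
  have hV' : Vᴴ * V = 1 := mem_unitaryGroup_iff'.mp hV
  refine ⟨V, hV, Uᴴ, Unitary.star_mem hU, fun k hk => ?_⟩
  have : trace (A * (V * diagProj n k * Uᴴ))
      = ∑ i : Fin n, if (i : ℕ) < k then (sv A i : ℂ) else 0 := by
    conv_lhs => rw [h]
    rw [trace_mul_comm, show V * diagProj n k * Uᴴ *
        (U * diagonal (fun i : Fin n => (sv A i : ℂ)) * Vᴴ)
      = V * (diagProj n k * (Uᴴ * U) * diagonal (fun i : Fin n => (sv A i : ℂ)) * Vᴴ) by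
        simp only [mul_assoc], trace_mul_comm, mul_assoc, hV', hU', diagProj]
    simp [trace]
  rw [this, Fin.sum_univ_eq_sum_range (fun i => if i < k then (sv A i : ℂ) else 0) n,
    ← Finset.sum_filter]
  congr 1
  ext i
  simp
  omega

theorem sum_range_ite_sub {s : ℕ → ℝ} {n l : ℕ} (hl : l ≤ n) (hs : s n = 0) :
    ∑ j ∈ Finset.range n, (if l < j + 1 then s j - s (j + 1) else 0) = s l := by
  rw [← Finset.sum_filter, show (Finset.range n).filter (fun j => l < j + 1) = Finset.Ico l n by
    ext j; simp; omega]
  have := Finset.sum_Ico_sub s hl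
  rw [← neg_inj, ← Finset.sum_neg_distrib]
  simp only [neg_sub]
  rw [this, hs, zero_sub]

theorem exists_unitary_eq_sum_diagProj {n : ℕ} (A : MatC n) :
    ∃ U ∈ unitaryGroup (Fin n) ℂ, ∃ V ∈ unitaryGroup (Fin n) ℂ,
      A = ∑ j ∈ Finset.range n, ((sv A j - sv A (j + 1) : ℝ) : ℂ) •
        (U * diagProj n (j + 1) * V) := by
  obtain ⟨U, hU, V, hV, h⟩ := exists_unitary_mul_diagonal_sv A
  refine ⟨U, hU, Vᴴ, Unitary.star_mem hV, ?_⟩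
  have : diagonal (fun i : Fin n => (sv A i : ℂ))
      = ∑ j ∈ Finset.range n, ((sv A j - sv A (j + 1) : ℝ) : ℂ) • diagProj n (j + 1) := by
    ext i k
    rw [Matrix.sum_apply]
    by_cases hik : i = k
    · subst hik
      simp only [diagProj, Matrix.smul_apply, diagonal_apply_eq]
      conv_lhs => rw [← sum_range_ite_sub i.2.le (sv_of_le A le_rfl)]
      push_cast
      refine Finset.sum_congr rfl fun j _ => ?_
      split_ifs <;> push_cast <;> simp only [smul_eq_mul, mul_one, mul_zero]
    · simp [diagProj, hik]
  conv_lhs => rw [h, this]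
  simp [Finset.mul_sum, Finset.sum_mul]

/-- If `p` and its companion contract the spectral norm, the trilinear form `Tr ((A • B) C)` is
bounded by the sum of products of singular values on partial isometries. -/
theorem norm_trace_diagProj_le_min {n : ℕ} {p : BilinProd n} (hsymm : ∀ A B, p A B = p B A)
    (hp : ∀ A B, ‖p A B‖ ≤ ‖A‖ * ‖B‖) (hr : ∀ A B, ‖rightProd p A B‖ ≤ ‖A‖ * ‖B‖)
    {U₁ V₁ U₂ V₂ U₃ V₃ : MatC n}
    (hU₁ : U₁ ∈ unitaryGroup (Fin n) ℂ) (hV₁ : V₁ ∈ unitaryGroup (Fin n) ℂ)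
    (hU₂ : U₂ ∈ unitaryGroup (Fin n) ℂ) (hV₂ : V₂ ∈ unitaryGroup (Fin n) ℂ)
    (hU₃ : U₃ ∈ unitaryGroup (Fin n) ℂ) (hV₃ : V₃ ∈ unitaryGroup (Fin n) ℂ) (i j k : ℕ) :
    ‖trace (p (U₁ * diagProj n i * V₁) (U₂ * diagProj n j * V₂) * (U₃ * diagProj n k * V₃))‖
      ≤ (min k (min i j) : ℕ) := by
  have bound {U V : MatC n} (hU : U ∈ unitaryGroup (Fin n) ℂ) (hV : V ∈ unitaryGroup (Fin n) ℂ)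
      (k : ℕ) : ‖U * diagProj n k * V‖ ≤ 1 :=
    (norm_mul_mul_of_mem_unitary hU hV _).trans_le (norm_diagProj_le_one n k)
  have contr {q : BilinProd n} (hq : ∀ A B, ‖q A B‖ ≤ ‖A‖ * ‖B‖) {A B : MatC n}
      (hA : ‖A‖ ≤ 1) (hB : ‖B‖ ≤ 1) : ‖q A B‖ ≤ 1 :=
    (hq A B).trans (mul_le_one₀ hA (norm_nonneg _) hB)
  have h₁ := bound hU₁ hV₁ i
  have h₂ := bound hU₂ hV₂ j
  have h₃ := bound hU₃ hV₃ k
  push_cast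
  refine le_min ?_ (le_min ?_ ?_)
  · exact norm_trace_mul_unitary_diagProj_le hU₃ hV₃ (contr hp h₁ h₂) k
  · rw [trace_rightProd]
    exact norm_trace_mul_unitary_diagProj_le hU₁ hV₁ (contr hr h₂ h₃) i
  -- `•_R` only frees the first argument; symmetry brings the second one there.
  · rw [hsymm, trace_rightProd]
    exact norm_trace_mul_unitary_diagProj_le hU₂ hV₂ (contr hr h₁ h₃) j

/-- Both factors telescope, and the minimum counts the `l < k` at which the increments `i` and `j`
both contribute. -/
theorem sum_sv_mul_sv {n k : ℕ} (hk : k ≤ n) (A B : MatC n) :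
    ∑ l ∈ Finset.range k, sv A l * sv B l
      = ∑ i ∈ Finset.range n, ∑ j ∈ Finset.range n, (sv A i - sv A (i + 1)) *
          ((sv B j - sv B (j + 1)) * (min k (min (i + 1) (j + 1)) : ℕ)) := by
  have hl : ∀ l ∈ Finset.range k, sv A l * sv B l
      = ∑ i ∈ Finset.range n, ∑ j ∈ Finset.range n, (sv A i - sv A (i + 1)) *
          ((sv B j - sv B (j + 1)) * if l < i + 1 ∧ l < j + 1 then 1 else 0) := by
    intro l hl
    have hln : l ≤ n := (Finset.mem_range.mp hl).le.trans hk
    rw [← sum_range_ite_sub (s := sv A) hln (sv_of_le A le_rfl),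
      ← sum_range_ite_sub (s := sv B) hln (sv_of_le B le_rfl), Finset.sum_mul_sum]
    refine Finset.sum_congr rfl fun i _ => Finset.sum_congr rfl fun j _ => ?_
    by_cases h₁ : l < i + 1 <;> by_cases h₂ : l < j + 1 <;> simp [h₁, h₂]
  rw [Finset.sum_congr rfl hl, Finset.sum_comm]
  refine Finset.sum_congr rfl fun i _ => ?_
  rw [Finset.sum_comm]
  refine Finset.sum_congr rfl fun j _ => ?_
  rw [← Finset.mul_sum, ← Finset.mul_sum, Finset.sum_boole]
  congr 4
  rw [← Finset.card_range (min k _)]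
  congr 1
  ext l
  simp

theorem sum_sv_le_of_contractive {n : ℕ} {p : BilinProd n} (hsymm : ∀ A B, p A B = p B A)
    (hp : ∀ A B, ‖p A B‖ ≤ ‖A‖ * ‖B‖) (hr : ∀ A B, ‖rightProd p A B‖ ≤ ‖A‖ * ‖B‖)
    (A B : MatC n) {k : ℕ} (hk : k ≤ n) :
    ∑ i ∈ Finset.range k, sv (p A B) i ≤ ∑ i ∈ Finset.range k, sv A i * sv B i := by
  obtain ⟨U₃, hU₃, V₃, hV₃, h₃⟩ := exists_unitary_trace_eq_sum_sv (p A B)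
  obtain ⟨U₁, hU₁, V₁, hV₁, h₁⟩ := exists_unitary_eq_sum_diagProj A
  obtain ⟨U₂, hU₂, V₂, hV₂, h₂⟩ := exists_unitary_eq_sum_diagProj B
  have hnorm : ∑ i ∈ Finset.range k, sv (p A B) i
      = ‖trace (p A B * (U₃ * diagProj n k * V₃))‖ := by
    rw [h₃ k hk, ← Complex.ofReal_sum, Complex.norm_real, Real.norm_of_nonneg]
    exact Finset.sum_nonneg fun i _ => sv_nonneg _ i
  have hexp : p A B = ∑ i ∈ Finset.range n, ∑ j ∈ Finset.range n,
      ((sv A i - sv A (i + 1) : ℝ) : ℂ) • ((sv B j - sv B (j + 1) : ℝ) : ℂ) •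
        p (U₁ * diagProj n (i + 1) * V₁) (U₂ * diagProj n (j + 1) * V₂) := by
    conv_lhs => rw [h₁, h₂]
    simp only [map_sum, map_smul, LinearMap.sum_apply, LinearMap.smul_apply, Finset.smul_sum]
    rw [Finset.sum_comm]
    refine Finset.sum_congr rfl fun i _ => Finset.sum_congr rfl fun j _ => smul_comm _ _ _
  have hd (M : MatC n) (i : ℕ) : ‖((sv M i - sv M (i + 1) : ℝ) : ℂ)‖ = sv M i - sv M (i + 1) := by
    rw [Complex.norm_real, Real.norm_of_nonneg (sub_nonneg.mpr (sv_antitone M (Nat.le_succ i)))]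
  rw [hnorm, sum_sv_mul_sv hk, hexp]
  simp only [Finset.sum_mul, trace_sum, smul_mul_assoc, trace_smul, smul_eq_mul]
  refine norm_sum_le_of_le _ fun i _ => norm_sum_le_of_le _ fun j _ => ?_
  rw [norm_mul, norm_mul, hd, hd]
  have hA : 0 ≤ sv A i - sv A (i + 1) := sub_nonneg.mpr (sv_antitone A (Nat.le_succ i))
  have hB : 0 ≤ sv B j - sv B (j + 1) := sub_nonneg.mpr (sv_antitone B (Nat.le_succ j))
  gcongr
  exact norm_trace_diagProj_le_min hsymm hp hr hU₁ hV₁ hU₂ hV₂ hU₃ hV₃ _ _ _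

theorem norm_trace_mul_le_sum_sv {n : ℕ} (X B : MatC n) :
    ‖trace (X * B)‖ ≤ (∑ i ∈ Finset.range n, sv X i) * ‖B‖ := by
  obtain ⟨U, hU, V, hV, h⟩ := exists_unitary_mul_diagonal_sv X
  rw [trace_mul_comm, mul_comm _ ‖B‖, ← Fin.sum_univ_eq_sum_range]
  conv_lhs => rw [h]
  refine (norm_trace_mul_unitary_diagonal_le hU (Unitary.star_mem hV) B _).trans_eq ?_
  simp [abs_of_nonneg (sv_nonneg X _)]

/-- The norm is attained as a trace against some `C` of rank at most one, for which the sum `∑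
σ_i(C) σ_i(A)` collapses to its first term. -/
theorem norm_rightProd_le_of_sum_sv_le {n : ℕ} {p : BilinProd n}
    (h : ∀ A B, ∑ i ∈ Finset.range n, sv (p A B) i ≤ ∑ i ∈ Finset.range n, sv A i * sv B i)
    (A B : MatC n) : ‖rightProd p A B‖ ≤ ‖A‖ * ‖B‖ := by
  rcases n.eq_zero_or_pos with rfl | hn
  · rw [norm_eq_sv_zero, sv_of_le _ le_rfl]
    positivity
  obtain ⟨U, hU, V, hV, hX⟩ := exists_unitary_trace_eq_sum_sv (rightProd p A B)
  set C := U * diagProj n 1 * V with hC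
  have hC1 : sv C 0 ≤ 1 := by
    rw [← norm_eq_sv_zero, hC, norm_mul_mul_of_mem_unitary hU hV]
    exact norm_diagProj_le_one n 1
  have hC0 : ∀ i, i ≠ 0 → sv C i = 0 := fun i hi => by
    refine sv_eq_zero_of_rank_le ?_
    calc C.rank ≤ (U * diagProj n 1).rank := rank_mul_le_left _ _
      _ ≤ (diagProj n 1).rank := rank_mul_le_right _ _
      _ ≤ 1 := rank_diagProj_le n 1
      _ ≤ i := Nat.one_le_iff_ne_zero.mpr hi
  calc ‖rightProd p A B‖ = ‖trace (rightProd p A B * C)‖ := by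
        rw [hX 1 hn, norm_eq_sv_zero]
        simp [abs_of_nonneg (sv_nonneg _ _)]
    _ = ‖trace (p C A * B)‖ := by rw [← trace_rightProd]
    _ ≤ (∑ i ∈ Finset.range n, sv (p C A) i) * ‖B‖ := norm_trace_mul_le_sum_sv _ _
    _ ≤ (∑ i ∈ Finset.range n, sv C i * sv A i) * ‖B‖ := by
        exact mul_le_mul_of_nonneg_right (h C A) (norm_nonneg B)
    _ = sv C 0 * sv A 0 * ‖B‖ := by
        rw [Finset.sum_eq_single_of_mem 0 (Finset.mem_range.mpr hn)
          fun i _ hi => by rw [hC0 i hi, zero_mul]]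
    _ ≤ 1 * sv A 0 * ‖B‖ := by
        gcongr
        exact sv_nonneg A 0
    _ = ‖A‖ * ‖B‖ := by rw [one_mul, norm_eq_sv_zero A]

theorem theorem4p1 (n : ℕ) (p : BilinProd n) (hsymm : ∀ A B : MatC n, p A B = p B A) :
    (∀ A B : MatC n, ∀ k : ℕ, 1 ≤ k → k ≤ n →
        ∑ i ∈ Finset.range k, sv (p A B) i ≤ ∑ i ∈ Finset.range k, sv A i * sv B i) ↔
      ((∀ A B : MatC n, sv (p A B) 0 ≤ sv A 0 * sv B 0) ∧
        (∀ A B : MatC n, sv (rightProd p A B) 0 ≤ sv A 0 * sv B 0)) := by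
  constructor
  · intro h
    rcases n.eq_zero_or_pos with rfl | hn
    -- For `n = 0` no `k` is admissible, but all singular values vanish.
    · simp [sv_of_le]
    refine ⟨fun A B => by simpa using h A B 1 le_rfl hn, fun A B => ?_⟩
    simpa only [norm_eq_sv_zero] using
      norm_rightProd_le_of_sum_sv_le (fun A B => h A B n hn le_rfl) A B
  · rintro ⟨hp, hr⟩ A B k - hk
    simp only [← norm_eq_sv_zero] at hp hr
    exact sum_sv_le_of_contractive hsymm hp hr A B hk
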